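/- Conventions. All graphs are finite and simple. A caterpillar is a tree such that removing all its leaves (degree-one vertices) leaves a path, called its spine; for $\Delta\ge 2$ it is $\Delta$-regular if its spine has at least one vertex and every spine vertex has degree $\Delta$ in the tree. A packing of $n$-vertex graphs $G_1,\dots,G_h$ is an $n$-vertex graph $G$ (the host graph) that contains copies of $G_1,\dots,G_h$ as pairwise edge-disjoint spanning subgraphs. A graph is $k$-planar if it has a drawing in the plane (vertices are distinct points, edges are simple arcs joining their end-vertices and passing through no other vertex) in which every edge is crossed at most $k$ times, where the crossings on an edge $e$ are the pairs of an edge $e'\neq e$ and a non-vertex point common to $e$ and $e'$; a packing is $k$-planar if its host graph is. Theorem. There is an absolute constant $c$ such that the following holds for all integers $h\ge 1$ and $n$. Let $C_1,\dots,C_h$ be $n$-vertex caterpillars such that $C_i$ is $\Delta_i$-regular for $1\le i\le h$, and $\Delta_h\le\Delta_{h-1}\le\dots\le\Delta_1\le n-h$. If $$\sum_{i=1}^h\Delta_i\le n-1\qquad\text{and}\qquad \sum_{i=2}^h\left\lceil\frac{\Delta_i}{2}\right\rceil<\frac{n-(\Delta_1-1)}{2},$$ then $C_1,\dots,C_h$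 admit a $k$-planar packing for some $k\le c\,\Delta_1h^2$. -/

import Mathlib

/-- The spine of a graph: what is left after removing all leaves (vertices of degree one). -/
def spine {V : Type*} (G : SimpleGraph V) [G.LocallyFinite] : Set V :=
  {v | G.degree v ≠ 1}

/-- A caterpillar: a tree such that removing all leaves leaves a path. -/
def IsCaterpillar {V : Type*} (G : SimpleGraph V) [G.LocallyFinite] : Prop :=
  G.IsTree ∧ ∃ σ : ℕ, Nonempty (G.induce (spine G) ≃g SimpleGraph.pathGraph σ)

/-- A `Δ`-regular caterpillar (`Δ ≥ 2`): a caterpillar with at least one spine vertex all of whose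
spine vertices have degree `Δ`. -/
def IsRegularCaterpillar {V : Type*} (G : SimpleGraph V) [G.LocallyFinite] (Δ : ℕ) : Prop :=
  IsCaterpillar G ∧ 2 ≤ Δ ∧ (spine G).Nonempty ∧ ∀ v ∈ spine G, G.degree v = Δ

/-- A drawing of a graph in the plane: distinct vertices are distinct points, every edge is a
simple arc joining the points of its two end-vertices, and no edge passes through the point of
a vertex that is not one of its ends. -/
structure Drawing {V : Type*} (G : SimpleGraph V) where
  /-- the point representing a vertex -/
  point : V → ℝ × ℝ
  point_injective : Function.Injective point
  /-- the curve representing an edge (with an arbitrary direction of travel) -/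
  curve : G.edgeSet → unitInterval → ℝ × ℝ
  curve_continuous : ∀ e, Continuous (curve e)
  curve_injective : ∀ e, Function.Injective (curve e)
  curve_ends : ∀ e : G.edgeSet, s(curve e 0, curve e 1) = Sym2.map point (e : Sym2 V)
  curve_avoids : ∀ (e : G.edgeSet) (t : unitInterval) (v : V),
    curve e t = point v → v ∈ (e : Sym2 V)

/-- The crossings on the edge `e`: pairs of another edge `e'` and a point, not the point of a
vertex, that lies on both. (If several edges meet `e` in one point, each of them counts.) -/
def Drawing.crossings {V : Type*} {G : SimpleGraph V} (D : Drawing G) (e : G.edgeSet) :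
    Set (G.edgeSet × (ℝ × ℝ)) :=
  {c | c.1 ≠ e ∧ c.2 ∈ Set.range (D.curve e) ∧ c.2 ∈ Set.range (D.curve c.1) ∧
    c.2 ∉ Set.range D.point}

/-- A `k`-planar graph: one with a drawing in which every edge is crossed at most `k` times. -/
def IsKPlanar {V : Type*} (k : ℕ) (G : SimpleGraph V) : Prop :=
  ∃ D : Drawing G, ∀ e : G.edgeSet, (D.crossings e).encard ≤ k

/-- `G` is a packing of the graphs `C i` (host graph `G`): `G` contains copies of all the `C i` as
pairwise edge-disjoint spanning subgraphs. -/
def IsPacking {ι W : Type*} {V : ι → Type*} (C : ∀ i, SimpleGraph (V i)) (G : SimpleGraph W) :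
    Prop :=
  ∃ η : ∀ i, V i ≃ W,
    (∀ i, (C i).map (η i).toEmbedding ≤ G) ∧
    ∀ i j, i ≠ j →
      Disjoint ((C i).map (η i).toEmbedding).edgeSet ((C j).map (η j).toEmbedding).edgeSet

/-! Place the vertices in convex position and draw edges as chords, each recorded by an interval
`[b, a]` of integers read modulo `n`. The zigzag drawing of a `Δ`-regular caterpillar has one
interval of each length `1, …, n - 1`, and all its end-sums `a + b` lie in a window of `Δ` integers
(`zigzag_edge`). Rotating it by `r` moves the window by `2 * r`.

A chord determines its end-sum modulo `n`, so caterpillars with disjoint windows inside `[1, n]` are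
edge-disjoint (`IsChordOf.not_of_lt`). Rotations by sums of `⌈Δ i / 2⌉` stack the windows inside
`[1, L]` with `L = 2 * ∑_{i ≥ 2} ⌈Δ i / 2⌉ + Δ 1` (degrees numbered from 1), and the second
inequality is exactly `L ≤ n`.

If two lengths differ by at least `L`, end-sums in `[1, L]` force the shorter interval strictly
inside the longer, so the chords do not cross (`IsChordOf.lt_of_chordsCross`). Hence an edge crosses
at most `2 * L` edges of each caterpillar, and `L ≤ 2 * h * Δ 1`. -/

/-! ### Straight-line drawings in convex position. -/

/-- Two chords of a convex polygon with vertices `0, …, n - 1` cross. -/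
def ChordsCross {n : ℕ} (e e' : Sym2 (Fin n)) : Prop :=
  ∃ x y z w : Fin n, x < y ∧ y < z ∧ z < w ∧
    ((e = s(x, z) ∧ e' = s(y, w)) ∨ (e = s(y, w) ∧ e' = s(x, z)))

/-- The point of the unit parabola with abscissa `x`. -/
def parabolaPoint (x : ℝ) : ℝ × ℝ := (x, x ^ 2)

/-- The straight segment from `parabolaPoint x` to `parabolaPoint y`. -/
def parabolaChord (x y : ℝ) (t : unitInterval) : ℝ × ℝ :=
  (x + t * (y - x), x ^ 2 + t * (y ^ 2 - x ^ 2))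

/-- The supporting line has slope `x + y` and intercept `-x * y`; the product inequality places
`p.1` between the ends without ordering them. -/
theorem parabolaChord_mem {x y : ℝ} {p : ℝ × ℝ} (hp : p ∈ Set.range (parabolaChord x y)) :
    p.2 = (x + y) * p.1 - x * y ∧ 0 ≤ (p.1 - x) * (y - p.1) := by
  obtain ⟨⟨t, h0, h1⟩, rfl⟩ := hp
  refine ⟨by simp only [parabolaChord]; ring, ?_⟩
  have : (parabolaChord x y ⟨t, h0, h1⟩).1 = x + t * (y - x) := rfl
  rw [this, show (x + t * (y - x) - x) * (y - (x + t * (y - x))) = t * (1 - t) * (y - x) ^ 2 by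
    ring]
  have := sub_nonneg.2 h1
  positivity

/-- Lines of different slopes meet at most once. Equal slopes and a common point give equal
intercepts, so both pairs of ends have the same sum and product and coincide. -/
theorem parabolaChord_inter_unique {x y x' y' : ℝ} (hne : s(x, y) ≠ s(x', y')) {p q : ℝ × ℝ}
    (hp : p ∈ Set.range (parabolaChord x y)) (hp' : p ∈ Set.range (parabolaChord x' y'))
    (hq : q ∈ Set.range (parabolaChord x y)) (hq' : q ∈ Set.range (parabolaChord x' y')) :
    p = q := by
  have h1 := (parabolaChord_mem hp).1
  have h2 := (parabolaChord_mem hp').1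
  have h3 := (parabolaChord_mem hq).1
  have h4 := (parabolaChord_mem hq').1
  by_cases hs : x + y = x' + y'
  · exfalso
    have hprod : x * y = x' * y' := by rw [hs] at h1; linarith
    have : (x - x') * (x - y') = 0 := by
      rw [show (x - x') * (x - y') = x * x - x * (x' + y') + x' * y' by ring, ← hs, ← hprod]; ring
    apply hne
    rw [Sym2.eq_iff]
    rcases mul_eq_zero.1 this with h | h
    · left; constructor <;> linarith
    · right; constructor <;> linarith
  · have : (x + y - (x' + y')) * (p.1 - q.1) = 0 := by linear_combination h2 - h1 - (h4 - h3)
    have hpq : p.1 = q.1 := by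
      rcases mul_eq_zero.1 this with h | h
      · exact absurd (by linarith) hs
      · linarith
    exact Prod.ext hpq (by rw [h1, h3, hpq])

/-- The height of a chord above the parabola at abscissa `X` is `(X - x) * (y - X)`. It grows
strictly with the interval, so chords meeting in an inner point cannot have nested intervals. -/
theorem parabolaChord_interlace {x y x' y' : ℝ} (hxy : x < y) (hxy' : x' < y')
    (hne : ¬ (x = x' ∧ y = y')) {p : ℝ × ℝ}
    (hp : p ∈ Set.range (parabolaChord x y)) (hp' : p ∈ Set.range (parabolaChord x' y'))
    (h1 : p ≠ parabolaPoint x) (h2 : p ≠ parabolaPoint y) (h1' : p ≠ parabolaPoint x')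
    (h2' : p ≠ parabolaPoint y') :
    (x < x' ∧ x' < y ∧ y < y') ∨ (x' < x ∧ x < y' ∧ y' < y) := by
  have key : ∀ {x y : ℝ}, x < y → p ∈ Set.range (parabolaChord x y) → p ≠ parabolaPoint x →
      p ≠ parabolaPoint y → x < p.1 ∧ p.1 < y := by
    intro x y hxy hp h1 h2
    obtain ⟨he, hn⟩ := parabolaChord_mem hp
    have hx : p.1 ≠ x := fun h => h1 (Prod.ext h (by rw [he, h, parabolaPoint]; ring))
    have hy : p.1 ≠ y := fun h => h2 (Prod.ext h (by rw [he, h, parabolaPoint]; ring))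
    constructor
    · by_contra! h
      have := lt_of_le_of_ne h hx
      nlinarith
    · by_contra! h
      have := lt_of_le_of_ne h hy.symm
      nlinarith
  obtain ⟨a1, a2⟩ := key hxy hp h1 h2
  obtain ⟨b1, b2⟩ := key hxy' hp' h1' h2'
  have e1 := (parabolaChord_mem hp).1
  have e2 := (parabolaChord_mem hp').1
  have e3 : (p.1 - x) * (y - p.1) = (p.1 - x') * (y' - p.1) := by linear_combination e2 - e1
  rcases lt_trichotomy x x' with hx | hx | hx
  · left
    refine ⟨hx, by linarith, ?_⟩
    by_contra! h
    nlinarith [mul_pos (sub_pos.2 hx) (sub_pos.2 a2), mul_nonneg (sub_nonneg.2 h) (sub_pos.2 b1).le]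
  · exfalso
    subst hx
    have := mul_left_cancel₀ (sub_pos.2 a1).ne' e3
    exact hne ⟨rfl, by linarith⟩
  · right
    refine ⟨hx, by linarith, ?_⟩
    by_contra! h
    nlinarith [mul_pos (sub_pos.2 hx) (sub_pos.2 b2), mul_nonneg (sub_nonneg.2 h) (sub_pos.2 a1).le]

theorem exists_endpoints {n : ℕ} (G : SimpleGraph (Fin n)) (e : G.edgeSet) :
    ∃ p : Fin n × Fin n, p.1 < p.2 ∧ (e : Sym2 (Fin n)) = s(p.1, p.2) := by
  obtain ⟨e, he⟩ := e
  induction e with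
  | _ x y =>
    rcases lt_or_gt_of_ne (G.ne_of_adj he) with h | h
    · exact ⟨(x, y), h, rfl⟩
    · exact ⟨(y, x), h, Sym2.eq_swap⟩

/-- Every graph on `Fin n` has a drawing (a straight-line one, with convex position of the
vertices) in which edges only cross as the corresponding chords of a convex polygon do. -/
theorem exists_convex_drawing {n : ℕ} (G : SimpleGraph (Fin n)) :
    ∃ D : Drawing G, ∀ e : G.edgeSet,
      (D.crossings e).encard ≤ {e' | e' ∈ G.edgeSet ∧ ChordsCross (e : Sym2 (Fin n)) e'}.encard := by
  choose ε hlt hε using exists_endpoints G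
  have hcast : ∀ {i j : Fin n}, ((i : ℕ) : ℝ) = ((j : ℕ) : ℝ) → i = j := fun h =>
    Fin.ext (by exact_mod_cast h)
  have hlt' : ∀ e, (((ε e).1 : ℕ) : ℝ) < (((ε e).2 : ℕ) : ℝ) := fun e => by
    exact_mod_cast hlt e
  let D : Drawing G :=
    { point := fun i => parabolaPoint (i : ℕ)
      point_injective := fun i j h => hcast (congrArg Prod.fst h)
      curve := fun e => parabolaChord ((ε e).1 : ℕ) ((ε e).2 : ℕ)
      curve_continuous := fun e => by unfold parabolaChord; fun_prop
      curve_injective := fun e s t h => by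
        have h1 := congrArg Prod.fst h
        simp only [parabolaChord, add_right_inj] at h1
        exact Subtype.ext (mul_right_cancel₀ (sub_pos.2 (hlt' e)).ne' h1)
      curve_ends := fun e => by
        rw [hε e]
        simp [parabolaChord, parabolaPoint]
      curve_avoids := fun e t v h => by
        have h1 := (parabolaChord_mem ⟨t, h⟩).1
        have h2 : (((v : ℕ) : ℝ) - ((ε e).1 : ℕ)) * (((v : ℕ) : ℝ) - ((ε e).2 : ℕ)) = 0 := by
          simp only [parabolaPoint] at h1
          linear_combination h1
        rw [hε e, Sym2.mem_iff]
        rcases mul_eq_zero.1 h2 with h | h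
        · exact Or.inl (hcast (by linarith))
        · exact Or.inr (hcast (by linarith)) }
  refine ⟨D, fun e => ?_⟩
  have hsym : ∀ {e e' : G.edgeSet}, e' ≠ e →
      s((((ε e).1 : ℕ) : ℝ), (((ε e).2 : ℕ) : ℝ)) ≠ s((((ε e').1 : ℕ) : ℝ), (((ε e').2 : ℕ) : ℝ)) := by
    intro e e' hne h
    apply hne
    apply Subtype.ext
    rw [hε, hε]
    rw [Sym2.eq_iff] at h ⊢
    rcases h with ⟨h1, h2⟩ | ⟨h1, h2⟩
    · exact Or.inl ⟨(hcast h1).symm, (hcast h2).symm⟩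
    · exact Or.inr ⟨(hcast h2).symm, (hcast h1).symm⟩
  -- A crossing is determined by its other edge, since distinct chords share at most one point.
  refine Set.encard_le_encard_of_injOn (f := fun c => (c.1 : Sym2 (Fin n))) ?_ ?_
  · rintro ⟨e', p⟩ ⟨hne, hp, hp', hv⟩
    have hpt : ∀ i : Fin n, p ≠ parabolaPoint (i : ℕ) := fun i h => hv ⟨i, h.symm⟩
    refine ⟨e'.2, ?_⟩
    have := parabolaChord_interlace (hlt' e) (hlt' e')
      (fun h => hsym hne (by rw [h.1, h.2])) hp hp' (hpt _) (hpt _) (hpt _) (hpt _)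
    simp only [Nat.cast_lt, Fin.val_fin_lt] at this
    rcases this with ⟨h1, h2, h3⟩ | ⟨h1, h2, h3⟩
    · exact ⟨_, _, _, _, h1, h2, h3, Or.inl ⟨hε e, hε e'⟩⟩
    · exact ⟨_, _, _, _, h1, h2, h3, Or.inr ⟨hε e, hε e'⟩⟩
  · rintro ⟨e', p⟩ ⟨hne, hp, hp', hv⟩ ⟨e'', q⟩ ⟨_, hq, hq', _⟩ h
    have h' : e' = e'' := Subtype.ext h
    subst h'
    have hpq := parabolaChord_inter_unique (hsym hne) hp hp' hq hq'
    exact Prod.ext rfl hpq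

/-! ### The zigzag on the integer line. -/

/-- The rank of the `q`-th spine vertex in the zigzag order of a caterpillar whose spine vertices
have degree `m + 1`. -/
def spineRank (m q : ℕ) : ℕ := if q = 0 then 0 else q * m + 1

/-- The position on the line of the vertex of a given rank in the zigzag drawing of a caterpillar
whose spine vertices have degree `m + 1`: it is extended `m` times to the right, then `m` times to
the left, and so on. -/
def zigzag (m : ℕ) : ℕ → ℤ
  | 0 => 0
  | t + 1 =>
    if Even ((t - 1) / m) then 1 + t - ((((t - 1) / m + 1) / 2 * m : ℕ) : ℤ)
    else -t + ((((t - 1) / m + 1) / 2 * m : ℕ) : ℤ)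

/-- The `t`-th edge of the zigzag is one of those from the `q`-th spine vertex to a later vertex. -/
def IsChildEdge (m q t : ℕ) : Prop := (q * m < t ∧ t ≤ q * m + m) ∨ (t = 0 ∧ q = 0)

/-- Each spine vertex owns a block of `m` consecutive indices. The first has no predecessor and owns
one more, `t = 0`, which truncated subtraction sends to block `0`. -/
theorem IsChildEdge.div_eq {m q t : ℕ} (h : IsChildEdge m q t) : (t - 1) / m = q := by
  rcases h with ⟨h1, h2⟩ | ⟨rfl, rfl⟩
  · apply Nat.div_eq_of_lt_le
    · omega
    · rw [Nat.succ_mul]; omega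
  · simp

theorem isChildEdge_div {m : ℕ} (hm : 1 ≤ m) (t : ℕ) : IsChildEdge m ((t - 1) / m) t := by
  rcases t with _ | t
  · right; simp
  · left
    have h1 := Nat.div_add_mod t m
    have h2 := Nat.mod_lt t hm
    rw [mul_comm] at h1
    simp only [Nat.add_sub_cancel]
    omega

theorem zigzag_succ_even {m k t : ℕ} (h : IsChildEdge m (2 * k) t) :
    zigzag m (t + 1) = 1 + t - k * m := by
  have : (2 * k + 1) / 2 = k := by omega
  simp [zigzag, h.div_eq, this]

theorem zigzag_succ_odd {m k t : ℕ} (h : IsChildEdge m (2 * k + 1) t) :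
    zigzag m (t + 1) = -t + (k + 1) * m := by
  have : (2 * k + 1 + 1) / 2 = k + 1 := by omega
  have h2 : ¬ Even (2 * k + 1) := by simp
  simp only [zigzag, h.div_eq, this, if_neg h2]
  push_cast
  ring

/-- A spine vertex other than the first is the last child of its predecessor, so its position is
given by the formula for the opposite parity. -/
theorem zigzag_spineRank_even {m : ℕ} (hm : 1 ≤ m) (k : ℕ) :
    zigzag m (spineRank m (2 * k)) = -(k * m) := by
  rcases k with _ | k
  · simp [spineRank, zigzag]
  · have h : IsChildEdge m (2 * k + 1) (2 * (k + 1) * m) := by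
      left; constructor <;> nlinarith
    have : spineRank m (2 * (k + 1)) = 2 * (k + 1) * m + 1 := by simp [spineRank]
    rw [this, zigzag_succ_odd h]
    push_cast
    ring

theorem zigzag_spineRank_odd {m : ℕ} (hm : 1 ≤ m) (k : ℕ) :
    zigzag m (spineRank m (2 * k + 1)) = 1 + (k + 1) * m := by
  have h : IsChildEdge m (2 * k) ((2 * k + 1) * m) := by
    left; constructor <;> nlinarith
  have : spineRank m (2 * k + 1) = (2 * k + 1) * m + 1 := by simp [spineRank]
  rw [this, zigzag_succ_even h]
  push_cast
  ring

/-- The `t`-th edge of the zigzag has length `t + 1`, and the sum of its ends is between `1` and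
`m + 1`. -/
theorem zigzag_edge {m : ℕ} (hm : 1 ≤ m) {q t : ℕ} (h : IsChildEdge m q t) :
    ∃ a b : ℤ, a - b = t + 1 ∧ 1 ≤ a + b ∧ a + b ≤ m + 1 ∧
      ((zigzag m (t + 1) = a ∧ zigzag m (spineRank m q) = b) ∨
        (zigzag m (t + 1) = b ∧ zigzag m (spineRank m q) = a)) := by
  rcases Nat.even_or_odd' q with ⟨k, rfl | rfl⟩
  · refine ⟨_, _, ?_, ?_, ?_,
      Or.inl ⟨zigzag_succ_even h, zigzag_spineRank_even hm k⟩⟩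
    · ring
    · rcases h with ⟨h1, h2⟩ | ⟨rfl, h2⟩
      · zify at h1; linarith
      · have : k = 0 := by omega
        simp [this]
    · rcases h with ⟨h1, h2⟩ | ⟨rfl, h2⟩
      · zify at h2; linarith
      · have : k = 0 := by omega
        simp [this]
  · refine ⟨_, _, ?_, ?_, ?_,
      Or.inr ⟨zigzag_succ_odd h, zigzag_spineRank_odd hm k⟩⟩
    · ring
    · rcases h with ⟨h1, h2⟩ | ⟨rfl, h2⟩
      · zify at h2; linarith
      · omega
    · rcases h with ⟨h1, h2⟩ | ⟨rfl, h2⟩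
      · zify at h1; linarith
      · omega

/-- The vertex of rank `y` extends the interval of the earlier ones by one at one of its ends. -/
theorem zigzag_sub {m : ℕ} (hm : 1 ≤ m) {x y : ℕ} (hxy : x < y) :
    (1 ≤ zigzag m y - zigzag m x ∧ zigzag m y - zigzag m x ≤ y) ∨
      (1 ≤ zigzag m x - zigzag m y ∧ zigzag m x - zigzag m y ≤ y) := by
  obtain ⟨t, rfl⟩ : ∃ t, y = t + 1 := ⟨y - 1, by omega⟩
  have ht := isChildEdge_div hm t
  have hmono : ∀ {k l : ℕ}, k < l → (k : ℤ) * m + m ≤ l * m := fun {k l} h => by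
    have := Nat.mul_le_mul_right m (Nat.succ_le_of_lt h)
    zify at this
    linarith
  have hcase : ∀ {q t : ℕ}, IsChildEdge m q t →
      ((q : ℤ) * m < t ∧ (t : ℤ) ≤ q * m + m) ∨ (t = 0 ∧ q = 0) := fun {q t} h => by
    unfold IsChildEdge at h
    zify at h
    exact_mod_cast h
  rcases x with _ | t'
  · have h0 : zigzag m 0 = 0 := rfl
    rcases Nat.even_or_odd' ((t - 1) / m) with ⟨k, hk | hk⟩
    · rw [hk] at ht
      rw [h0, zigzag_succ_even ht]
      have hk0 : 0 ≤ (k : ℤ) * m := by positivity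
      rcases hcase ht with ⟨h1, h2⟩ | ⟨rfl, h2⟩
      · left; push_cast at *; constructor <;> nlinarith
      · have : k = 0 := by omega
        simp [this]
    · rw [hk] at ht
      rw [h0, zigzag_succ_odd ht]
      have hk0 : 0 ≤ (k : ℤ) * m := by positivity
      rcases hcase ht with ⟨h1, h2⟩ | ⟨rfl, h2⟩
      · right; push_cast at *; constructor <;> nlinarith
      · omega
  · have ht' := isChildEdge_div hm t'
    have hq : (t' - 1) / m ≤ (t - 1) / m := Nat.div_le_div_right (by omega)
    rcases Nat.even_or_odd' ((t - 1) / m) with ⟨k, hk | hk⟩ <;>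
    rcases Nat.even_or_odd' ((t' - 1) / m) with ⟨l, hl | hl⟩ <;>
    rw [hk] at ht hq <;> rw [hl] at ht' hq
    all_goals
      -- Even blocks extend to the right and odd ones to the left. With `l * m` and `k * m` compared
      -- here as atoms, each case becomes linear.
      have hlk : (l : ℤ) * m = k * m ∧ l = k ∨ (l : ℤ) * m + m ≤ k * m ∧ l < k := by
        rcases Nat.lt_or_ge l k with h | h
        · exact Or.inr ⟨hmono h, h⟩
        · have : l = k := by omega
          subst this
          simp
      have hl0 : 0 ≤ (l : ℤ) * m := by positivity
      have htt : (t' : ℤ) + 1 ≤ t := by omega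
      have hm1 : (1 : ℤ) ≤ m := by omega
      have c1 := hcase ht
      have c2 := hcase ht'
      push_cast at c1 c2
    · rw [zigzag_succ_even ht, zigzag_succ_even ht']
      left
      push_cast
      rcases hlk with ⟨hlk, h⟩ | ⟨hlk, h⟩ <;> rcases c1 with c1 | c1 <;> rcases c2 with c2 | c2 <;>
        first | omega | (constructor <;> linarith)
    · rw [zigzag_succ_even ht, zigzag_succ_odd ht']
      left
      push_cast
      rcases hlk with ⟨hlk, h⟩ | ⟨hlk, h⟩ <;> rcases c1 with c1 | c1 <;> rcases c2 with c2 | c2 <;>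
        first | omega | (constructor <;> linarith)
    · rw [zigzag_succ_odd ht, zigzag_succ_even ht']
      right
      push_cast
      rcases hlk with ⟨hlk, h⟩ | ⟨hlk, h⟩ <;> rcases c1 with c1 | c1 <;> rcases c2 with c2 | c2 <;>
        first | omega | (constructor <;> linarith)
    · rw [zigzag_succ_odd ht, zigzag_succ_odd ht']
      right
      push_cast
      rcases hlk with ⟨hlk, h⟩ | ⟨hlk, h⟩ <;> rcases c1 with c1 | c1 <;> rcases c2 with c2 | c2 <;>
        first | omega | (constructor <;> linarith)

/-! ### Numbering the vertices of a regular caterpillar. -/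

/-- In a connected graph with a vertex of degree at least two, no two leaves are adjacent. -/
theorem neighbor_of_leaf_mem_spine {V : Type*} {G : SimpleGraph V} [G.LocallyFinite]
    (hG : G.Connected) (hs : (spine G).Nonempty) {v w : V} (hv : v ∉ spine G)
    (h : G.Adj v w) : w ∈ spine G := by
  by_contra hw
  obtain ⟨s, hs⟩ := hs
  have hr := (SimpleGraph.reachable_iff_reflTransGen v s).1 (hG.preconnected v s)
  have hdeg : ∀ {x y z : V}, x ∉ spine G → G.Adj x y → G.Adj x z → z = y := by
    intro x y z hx hy hz
    have hx : G.degree x = 1 := not_not.1 hx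
    obtain ⟨_, _, hu⟩ := G.degree_eq_one_iff_existsUnique_adj.1 hx
    rw [hu _ hy, hu _ hz]
  -- Two adjacent leaves have no other neighbours, so no walk from `v` leaves `{v, w}`.
  have key : s = v ∨ s = w := by
    clear hs
    induction hr with
    | refl => exact Or.inl rfl
    | tail _ hxy ih =>
      rcases ih with rfl | rfl
      · exact Or.inr (hdeg hv h hxy)
      · exact Or.inl (hdeg hw h.symm hxy)
  rcases key with rfl | rfl
  · exact hv hs
  · exact hw hs

/-- The number of vertices of a regular caterpillar in terms of that of spine vertices. -/
theorem card_eq_of_degree_spine {V : Type*} [Fintype V] {G : SimpleGraph V} [DecidableRel G.Adj]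
    {m : ℕ} (hG : G.IsTree) (hdeg : ∀ v ∈ spine G, G.degree v = m + 1) :
    Fintype.card V = Nat.card (spine G) * m + 2 := by
  classical
  have h1 := hG.card_edgeFinset
  have h2 := G.sum_degrees_eq_twice_card_edges
  have h3 : ∑ v, G.degree v = Fintype.card V + Nat.card (spine G) * m := by
    have : ∀ v, G.degree v = 1 + if v ∈ spine G then m else 0 := fun v => by
      split_ifs with hv
      · rw [hdeg v hv, add_comm]
      · exact not_not.1 hv
    rw [Finset.sum_congr rfl fun v _ => this v, Finset.sum_add_distrib, ← Finset.sum_filter,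
      Finset.sum_const, Finset.sum_const, Nat.card_eq_fintype_card, Fintype.card_subtype]
    simp
  omega

/-- The vertices of a regular caterpillar can be numbered from `0` such that each edge joins a spine
vertex to a later vertex according to the pattern of the zigzag. -/
theorem exists_zigzag_rank {V : Type*} [Fintype V] (G : SimpleGraph V) [DecidableRel G.Adj]
    {m n : ℕ} (hC : IsRegularCaterpillar G (m + 1)) (hn : Fintype.card V = n) :
    ∃ ρ : V ≃ Fin n, ∀ u v, G.Adj u v → ∃ q t, IsChildEdge m q t ∧
      (((ρ u : ℕ) = t + 1 ∧ (ρ v : ℕ) = spineRank m q) ∨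
        ((ρ v : ℕ) = t + 1 ∧ (ρ u : ℕ) = spineRank m q)) := by
  classical
  obtain ⟨⟨htree, σ, ⟨φ⟩⟩, hm, hne, hdeg⟩ := hC
  have hm : 1 ≤ m := by omega
  have hcard : n = σ * m + 2 := by
    rw [← hn, card_eq_of_degree_spine htree hdeg, Nat.card_congr φ.toEquiv]
    simp
  set p : Fin σ → V := fun i => (φ.symm i : V) with hp
  have hps : ∀ i, p i ∈ spine G := fun i => (φ.symm i).2
  have hpinj : Function.Injective p := Subtype.val_injective.comp φ.symm.injective
  have hpadj : ∀ i j, G.Adj (p i) (p j) ↔ (i : ℕ) + 1 = j ∨ (j : ℕ) + 1 = i := by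
    intro i j
    rw [← SimpleGraph.pathGraph_adj, ← φ.symm.map_adj_iff]
    rfl
  -- The block of a vertex: its own index on the spine, or that of the unique neighbour of a leaf.
  have hQ : ∀ v, ∃ q : Fin σ, (v ∈ spine G → p q = v) ∧
      (v ∉ spine G → G.Adj v (p q) ∧ ∀ w, G.Adj v w → w = p q) := by
    intro v
    by_cases hv : v ∈ spine G
    · exact ⟨φ ⟨v, hv⟩, fun _ => by simp [hp], fun h => absurd hv h⟩
    · obtain ⟨w, hw, hu⟩ := G.degree_eq_one_iff_existsUnique_adj.1 (not_not.1 hv)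
      have hws := neighbor_of_leaf_mem_spine htree.connected hne hv hw
      have : p (φ ⟨w, hws⟩) = w := by simp [hp]
      exact ⟨φ ⟨w, hws⟩, fun h => absurd h hv, fun _ => by rw [this]; exact ⟨hw, hu⟩⟩
  choose Q hQs hQl using hQ
  have hQp : ∀ i, Q (p i) = i := fun i => hpinj (hQs _ (hps i))
  let L : Fin σ → Finset V := fun q => Finset.univ.filter fun v => v ∉ spine G ∧ Q v = q
  have hL : ∀ q (S : Finset V), (∀ v ∈ S, v ∈ spine G ∧ G.Adj (p q) v) →
      (L q).card + S.card ≤ m + 1 := by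
    intro q S hS
    rw [← hdeg _ (hps q), ← Finset.card_union_of_disjoint, ← G.card_neighborFinset_eq_degree]
    · apply Finset.card_le_card
      intro v hv
      rw [SimpleGraph.mem_neighborFinset]
      rcases Finset.mem_union.1 hv with hv | hv
      · obtain ⟨hvs, rfl⟩ := (Finset.mem_filter.1 hv).2
        exact (hQl v hvs).1.symm
      · exact (hS v hv).2
    · rw [Finset.disjoint_left]
      intro v hv hvS
      exact (Finset.mem_filter.1 hv).2.1 (hS v hvS).1
  -- Each existing spine neighbour uses up one of the `m + 1` edges at `p q`.
  have hLcard : ∀ q : Fin σ, (L q).card + (if (q : ℕ) = 0 then 0 else 1) +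
      (if (q : ℕ) + 1 = σ then 0 else 1) ≤ m + 1 := by
    intro q
    have hprev : (q : ℕ) ≠ 0 → ∃ i : Fin σ, (i : ℕ) + 1 = q := fun h =>
      ⟨⟨q - 1, by omega⟩, by simp only; omega⟩
    have hnext : (q : ℕ) + 1 ≠ σ → ∃ i : Fin σ, (q : ℕ) + 1 = i := fun h =>
      ⟨⟨q + 1, by omega⟩, rfl⟩
    split_ifs with h0 h1 h1
    · exact hL q ∅ (by simp)
    · obtain ⟨i, hi⟩ := hnext h1
      simpa using hL q {p i} (by simp [hps, hpadj, hi])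
    · obtain ⟨i, hi⟩ := hprev h0
      simpa using hL q {p i} (by simp [hps, hpadj, hi])
    · obtain ⟨i, hi⟩ := hprev h0
      obtain ⟨j, hj⟩ := hnext h1
      have hij : p i ≠ p j := fun h => by
        have := congrArg Fin.val (hpinj h)
        omega
      have := hL q {p i, p j} (by simp [hps, hpadj, hi, hj])
      rw [Finset.card_pair hij] at this
      omega
  have hidx : ∃ f : V → ℕ, (∀ v, v ∉ spine G → f v < (L (Q v)).card) ∧
      ∀ u v, u ∉ spine G → v ∉ spine G → Q u = Q v → f u = f v → u = v := by
    have hg : ∀ q, ∃ g : V → ℕ, (∀ v ∈ L q, g v < (L q).card) ∧ Set.InjOn g (L q) := by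
      intro q
      refine ⟨fun v => if h : v ∈ L q then ((L q).equivFin ⟨v, h⟩ : ℕ) else 0, ?_, ?_⟩
      · intro v hv
        simp only [hv, dif_pos]
        exact Fin.is_lt _
      · intro u hu v hv h
        simp only [Finset.mem_coe.1 hu, Finset.mem_coe.1 hv, dif_pos] at h
        simpa using (L q).equivFin.injective (Fin.ext h)
    choose g hg hginj using hg
    refine ⟨fun v => g (Q v) v, fun v hv => hg _ _ (by simp [L, hv]), fun u v hu hv hq h => ?_⟩
    exact hginj (Q v) (by simp [L, hu, hq]) (by simp [L, hv]) (by simpa only [hq] using h)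
  obtain ⟨f, hf, hfinj⟩ := hidx
  -- Within a block, the spine vertex comes first and its leaves follow.
  let rk : V → ℕ := fun v => if v ∈ spine G then spineRank m (Q v) else
    f v + (if (Q v : ℕ) = 0 then 1 else Q v * m + 2)
  have hrk_spine : ∀ v, v ∈ spine G → rk v = spineRank m (Q v) := fun v hv => if_pos hv
  have hrk_leaf : ∀ v, v ∉ spine G → rk v = f v + (if (Q v : ℕ) = 0 then 1 else Q v * m + 2) :=
    fun v hv => if_neg hv
  have hzero : ∀ q : Fin σ, (q : ℕ) = 0 → (q : ℕ) * m = 0 := fun q h => by rw [h, zero_mul]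
  have hlow : ∀ v, (Q v : ℕ) ≠ 0 → (Q v : ℕ) * m + 1 ≤ rk v := by
    intro v hq
    by_cases hv : v ∈ spine G
    · simp [hrk_spine v hv, spineRank, hq]
    · rw [hrk_leaf v hv, if_neg hq]; omega
  -- Only the last spine vertex lacks a successor, and its extra leaf may take one further rank.
  have hupp : ∀ v, rk v ≤ (Q v : ℕ) * m + m + (if (Q v : ℕ) + 1 = σ then 1 else 0) := by
    intro v
    by_cases hv : v ∈ spine G
    · rw [hrk_spine v hv, spineRank]; split_ifs <;> omega
    · rw [hrk_leaf v hv]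
      have h1 := hf v hv
      have h2 := hLcard (Q v)
      have h3 := hzero (Q v)
      split_ifs at h2 ⊢ <;> omega
  have hlt : ∀ u v, Q u < Q v → rk u < rk v := by
    intro u v huv
    have h1 := hlow v (by have : (Q u : ℕ) < Q v := huv; omega)
    have h2 := hupp u
    have h3 := Nat.mul_le_mul_right m (Nat.succ_le_of_lt (show (Q u : ℕ) < Q v from huv))
    rw [Nat.succ_mul] at h3
    rw [if_neg (by have : (Q u : ℕ) < Q v := huv; omega)] at h2
    omega
  have hleaf_gt : ∀ v, v ∉ spine G → spineRank m (Q v) < rk v := by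
    intro v hv
    rw [hrk_leaf v hv, spineRank]
    split_ifs <;> omega
  have hinj : Function.Injective rk := by
    intro u v h
    have hq : Q u = Q v := by
      rcases lt_trichotomy (Q u) (Q v) with hq | hq | hq
      · exact absurd h (hlt _ _ hq).ne
      · exact hq
      · exact absurd h (hlt _ _ hq).ne'
    by_cases hu : u ∈ spine G <;> by_cases hv : v ∈ spine G
    · rw [← hQs u hu, ← hQs v hv, hq]
    · have := hleaf_gt v hv
      rw [← h, hrk_spine u hu, hq] at this
      omega
    · have := hleaf_gt u hu
      rw [h, hrk_spine v hv, hq] at this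
      omega
    · refine hfinj u v hu hv hq ?_
      rw [hrk_leaf u hu, hrk_leaf v hv, hq] at h
      omega
  have hrkn : ∀ v, rk v < n := by
    intro v
    have h1 := hupp v
    have h2 := Nat.mul_le_mul_right m (Nat.succ_le_of_lt (Q v).2)
    rw [Nat.succ_mul] at h2
    split_ifs at h1 <;> omega
  let ρ : V → Fin n := fun v => ⟨rk v, hrkn v⟩
  -- Upper bounds on the numbers of leaves suffice: surjectivity follows from injectivity by
  -- counting.
  have hρ : Function.Bijective ρ := by
    rw [Fintype.bijective_iff_injective_and_card]
    exact ⟨fun u v h => hinj (congrArg Fin.val h), by simp [hn]⟩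
  refine ⟨Equiv.ofBijective ρ hρ, ?_⟩
  have hleaf : ∀ u v, u ∉ spine G → G.Adj u v → ∃ q t, IsChildEdge m q t ∧
      rk u = t + 1 ∧ rk v = spineRank m q := by
    intro u v hu huv
    have hv := (hQl u hu).2 v huv
    refine ⟨Q u, rk u - 1, ?_, ?_, ?_⟩
    · have h1 := hf u hu
      have h2 := hLcard (Q u)
      rw [hrk_leaf u hu]
      have h3 := hzero (Q u)
      unfold IsChildEdge
      split_ifs at h2 ⊢ <;> omega
    · have := hleaf_gt u hu
      omega
    · rw [hv, hrk_spine _ (hps _), hQp]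
  have hsp : ∀ i j : Fin σ, (i : ℕ) + 1 = j → ∃ q t, IsChildEdge m q t ∧
      rk (p j) = t + 1 ∧ rk (p i) = spineRank m q := by
    intro i j hij
    refine ⟨i, (i + 1) * m, Or.inl ?_, ?_, ?_⟩
    · rw [Nat.succ_mul]; omega
    · rw [hrk_spine _ (hps _), hQp, spineRank, if_neg (by omega), hij]
    · rw [hrk_spine _ (hps _), hQp]
  intro u v huv
  change ∃ q t, IsChildEdge m q t ∧ ((rk u = t + 1 ∧ rk v = spineRank m q) ∨
    (rk v = t + 1 ∧ rk u = spineRank m q))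
  by_cases hu : u ∈ spine G
  · by_cases hv : v ∈ spine G
    · rw [← hQs u hu, ← hQs v hv, hpadj] at huv
      rcases huv with h | h
      · obtain ⟨q, t, h1, h2⟩ := hsp _ _ h
        rw [hQs u hu, hQs v hv] at h2
        exact ⟨q, t, h1, Or.inr h2⟩
      · obtain ⟨q, t, h1, h2⟩ := hsp _ _ h
        rw [hQs u hu, hQs v hv] at h2
        exact ⟨q, t, h1, Or.inl h2⟩
    · obtain ⟨q, t, h1, h2⟩ := hleaf v u hv huv.symm
      exact ⟨q, t, h1, Or.inr h2⟩
  · obtain ⟨q, t, h1, h2⟩ := hleaf u v hu huv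
    exact ⟨q, t, h1, Or.inl h2⟩

/-! ### Chords of a circle classified by length and end-sum. -/

/-- The residue of an integer modulo `n`, as an element of `Fin n`. -/
def residue {n : ℕ} (hn : 0 < n) (z : ℤ) : Fin n :=
  ⟨(z % n).toNat, by have := Int.emod_lt_of_pos z (Int.natCast_pos.2 hn); omega⟩

theorem residue_val {n : ℕ} (hn : 0 < n) (z : ℤ) : ((residue hn z : ℕ) : ℤ) = z % n :=
  Int.toNat_of_nonneg (Int.emod_nonneg _ (by omega))

/-- The chord `e` of the `n`-gon, seen as a circle of circumference `n`, spans an interval of length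
`t + 1` whose ends have a sum between `lo` and `hi`. -/
def IsChordOf {n : ℕ} (lo hi : ℤ) (t : ℕ) (e : Sym2 (Fin n)) : Prop :=
  t + 1 < n ∧ ∃ a b : ℤ, a - b = t + 1 ∧ lo ≤ a + b ∧ a + b ≤ hi ∧
    ∃ x y : Fin n, e = s(x, y) ∧ ((x : ℕ) : ℤ) = a % n ∧ ((y : ℕ) : ℤ) = b % n

theorem IsChordOf.mono {n : ℕ} {lo hi lo' hi' : ℤ} {t : ℕ} {e : Sym2 (Fin n)}
    (h : IsChordOf lo hi t e) (h1 : lo' ≤ lo) (h2 : hi ≤ hi') : IsChordOf lo' hi' t e := by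
  obtain ⟨ht, a, b, h3, h4, h5, h6⟩ := h
  exact ⟨ht, a, b, h3, by omega, by omega, h6⟩

/-- An end-sum in `[1, n]` and a length below `n` force `1 ≤ a < n` and `-n < b < n`, so only `b`
can wrap around. -/
theorem IsChordOf.exists_endpoints {n : ℕ} {lo hi : ℤ} {t : ℕ} {e : Sym2 (Fin n)}
    (h : IsChordOf lo hi t e) (hlo : 1 ≤ lo) (hhi : hi ≤ n) :
    ∃ a b : ℤ, a - b = t + 1 ∧ lo ≤ a + b ∧ a + b ≤ hi ∧
      ∃ x y : Fin n, e = s(x, y) ∧ ((x : ℕ) : ℤ) = a ∧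
        (((y : ℕ) : ℤ) = b ∨ ((y : ℕ) : ℤ) = b + n) := by
  obtain ⟨ht, a, b, h3, h4, h5, x, y, he, hx, hy⟩ := h
  refine ⟨a, b, h3, h4, h5, x, y, he, ?_, ?_⟩
  · rw [hx, Int.emod_eq_of_lt] <;> omega
  · rcases lt_or_ge b 0 with hb | hb
    · right
      rw [hy, ← Int.add_emod_right, Int.emod_eq_of_lt] <;> omega
    · left
      rw [hy, Int.emod_eq_of_lt] <;> omega

/-- The ends of a chord determine `a + b` modulo `n`, and the integers of `[1, n]` have distinct
residues. -/
theorem IsChordOf.not_of_lt {n : ℕ} {lo hi lo' hi' : ℤ} {t t' : ℕ} {e : Sym2 (Fin n)}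
    (h : IsChordOf lo hi t e) (h' : IsChordOf lo' hi' t' e) (h1 : 1 ≤ lo) (h2 : hi < lo')
    (h3 : hi' ≤ n) : False := by
  obtain ⟨a', b', c1', c2', c3', x', y', he', hx', hy'⟩ :=
    h'.exists_endpoints (by obtain ⟨_, a, b, _, _, _, _⟩ := h; omega) h3
  obtain ⟨a, b, c1, c2, c3, x, y, he, hx, hy⟩ := h.exists_endpoints h1 (by omega)
  rw [he, Sym2.eq_iff] at he'
  rcases he' with ⟨rfl, rfl⟩ | ⟨rfl, rfl⟩ <;> omega

/-- The end-sums differ by less than `L`. If the lengths differed by `L` or more, both ends of the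
shorter interval would lie strictly inside the longer one. -/
theorem IsChordOf.lt_of_chordsCross {n : ℕ} {L : ℤ} {t t' : ℕ} {e e' : Sym2 (Fin n)}
    (h : IsChordOf 1 L t e) (h' : IsChordOf 1 L t' e') (hL : L ≤ n) (hc : ChordsCross e e') :
    (t : ℤ) < t' + L ∧ (t' : ℤ) < t + L := by
  have ht := h.1
  have ht' := h'.1
  obtain ⟨a, b, c1, c2, c3, x, y, he, hx, hy⟩ := h.exists_endpoints le_rfl hL
  obtain ⟨a', b', c1', c2', c3', x', y', he', hx', hy'⟩ := h'.exists_endpoints le_rfl hL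
  obtain ⟨p, q, u, v, hpq, hqu, huv, hcase⟩ := hc
  rw [Fin.lt_def] at hpq hqu huv
  have hv := v.2
  subst he he'
  rcases hcase with ⟨h1, h2⟩ | ⟨h1, h2⟩ <;> rw [Sym2.eq_iff] at h1 h2 <;>
    rcases h1 with ⟨rfl, rfl⟩ | ⟨rfl, rfl⟩ <;> rcases h2 with ⟨rfl, rfl⟩ | ⟨rfl, rfl⟩ <;>
    rcases hy with hy | hy <;> rcases hy' with hy' | hy' <;> omega

/-- A regular caterpillar can be placed on `n` points of a circle such that its edges are chords
with different lengths and all sums of their ends in an interval with as many elements as the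
degree. -/
theorem exists_placement {V : Type*} [Fintype V] (G : SimpleGraph V) [DecidableRel G.Adj]
    {Δ n : ℕ} (hC : IsRegularCaterpillar G Δ) (hn : Fintype.card V = n) (r : ℕ) :
    ∃ (η : V ≃ Fin n) (E : ℕ → Sym2 (Fin n)), ∀ u v, G.Adj u v →
      ∃ t, IsChordOf (1 + 2 * r) (2 * r + Δ) t s(η u, η v) ∧ E t = s(η u, η v) := by
  have hn0 : 0 < n := by
    obtain ⟨v, _⟩ := hC.2.2.1
    rw [← hn]
    exact Fintype.card_pos_iff.2 ⟨v⟩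
  obtain ⟨m, rfl⟩ : ∃ m, Δ = m + 1 := ⟨Δ - 1, by have := hC.2.1; omega⟩
  have hm : 1 ≤ m := by have := hC.2.1; omega
  obtain ⟨ρ, hρ⟩ := exists_zigzag_rank G hC hn
  let pos : ℕ → Fin n := fun x => residue hn0 (zigzag m x + r)
  -- Positions of ranks `x < y` differ by between `1` and `y < n`, hence not by a multiple of `n`.
  have hne : ∀ x y : Fin n, x < y → pos x ≠ pos y := by
    intro x y hxy h
    have h1 : (zigzag m x + r) % n = (zigzag m y + r) % n := by
      rw [← residue_val hn0, ← residue_val hn0]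
      exact congrArg (fun z : Fin n => ((z : ℕ) : ℤ)) h
    have hdvd : (n : ℤ) ∣ _ := Int.ModEq.dvd h1
    have hy := y.2
    rcases zigzag_sub hm hxy with ⟨h2, h3⟩ | ⟨h2, h3⟩
    · have := Int.le_of_dvd (by omega) hdvd
      omega
    · have := Int.le_of_dvd (by omega) ((dvd_neg).2 hdvd)
      omega
  have hinj : Function.Injective fun x : Fin n => pos x := by
    intro x y h
    rcases lt_trichotomy x y with hxy | hxy | hxy
    · exact absurd h (hne _ _ hxy)
    · exact hxy
    · exact absurd h.symm (hne _ _ hxy)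
  refine ⟨ρ.trans (Equiv.ofBijective _ (Finite.injective_iff_bijective.1 hinj)),
    -- This lists the only possible edge for each `t`, so counting edges reduces to counting
    -- indices.
    fun t => s(pos (t + 1), pos (spineRank m ((t - 1) / m))), ?_⟩
  have key : ∀ u v q t, IsChildEdge m q t → (ρ u : ℕ) = t + 1 → (ρ v : ℕ) = spineRank m q →
      IsChordOf (1 + 2 * r) (2 * r + (m + 1 : ℕ)) t s(pos (ρ u), pos (ρ v)) ∧
        s(pos (t + 1), pos (spineRank m ((t - 1) / m))) = s(pos (ρ u), pos (ρ v)) := by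
    intro u v q t hqt hu hv
    have ht : t + 1 < n := hu ▸ (ρ u).2
    rw [hu, hv, hqt.div_eq]
    refine ⟨⟨ht, ?_⟩, rfl⟩
    obtain ⟨a, b, h1, h2, h3, h4⟩ := zigzag_edge hm hqt
    refine ⟨a + r, b + r, by omega, by omega, by push_cast; omega, ?_⟩
    rcases h4 with ⟨h4, h5⟩ | ⟨h4, h5⟩
    · exact ⟨_, _, rfl, by rw [residue_val, h4], by rw [residue_val, h5]⟩
    · exact ⟨_, _, Sym2.eq_swap, by rw [residue_val, h5], by rw [residue_val, h4]⟩
  intro u v huv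
  obtain ⟨q, t, hqt, ⟨h1, h2⟩ | ⟨h1, h2⟩⟩ := hρ u v huv
  · exact ⟨t, key u v q t hqt h1 h2⟩
  · have := key v u q t hqt h1 h2
    rw [Sym2.eq_swap (a := pos (ρ v))] at this
    exact ⟨t, this⟩

/-- Edges crossing `e` have indices within `L` of `t`, and a caterpillar has at most one edge per
index. -/
theorem encard_crossings_le {n h L t : ℕ} {e : Sym2 (Fin n)} (S : Set (Sym2 (Fin n)))
    (E : Fin h → ℕ → Sym2 (Fin n)) (hL : L ≤ n) (he : IsChordOf 1 L t e)
    (hS : ∀ e' ∈ S, ∃ i t', IsChordOf 1 L t' e' ∧ E i t' = e') :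
    {e' | e' ∈ S ∧ ChordsCross e e'}.encard ≤ (h * (2 * L) : ℕ) := by
  classical
  let T : Finset (Sym2 (Fin n)) :=
    (Finset.univ ×ˢ Finset.Ico (t - L) (t + L)).image fun p : Fin h × ℕ => E p.1 p.2
  have hsub : {e' | e' ∈ S ∧ ChordsCross e e'} ⊆ T := by
    rintro e' ⟨he', hc⟩
    obtain ⟨i, t', h1, h2⟩ := hS e' he'
    have := he.lt_of_chordsCross h1 (by omega) hc
    simp only [T, Finset.coe_image, Set.mem_image, Finset.mem_coe, Finset.mem_product,
      Finset.mem_univ, true_and, Finset.mem_Ico]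
    exact ⟨(i, t'), ⟨by omega, by omega⟩, h2⟩
  refine (Set.encard_le_encard hsub).trans ?_
  rw [Set.encard_coe_eq_coe_finsetCard, Nat.cast_le]
  refine Finset.card_image_le.trans ?_
  rw [Finset.card_product, Finset.card_univ, Fintype.card_fin, Nat.card_Ico]
  exact Nat.mul_le_mul_left _ (by omega)

/-! ### Stacking the windows. -/

theorem ceil_natCast_div_two (d : ℕ) : (⌈(d : ℝ) / 2⌉ : ℝ) = (((d + 1) / 2 : ℕ) : ℝ) := by
  have : ⌈(d : ℝ) / 2⌉ = (((d + 1) / 2 : ℕ) : ℤ) := by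
    rw [Int.ceil_eq_iff]
    obtain ⟨k, rfl | rfl⟩ := Nat.even_or_odd' d
    · rw [show (2 * k + 1) / 2 = k by omega]
      push_cast
      constructor <;> linarith
    · rw [show (2 * k + 1 + 1) / 2 = k + 1 by omega]
      push_cast
      constructor <;> linarith
  rw [this, Int.cast_natCast]

theorem theorem3 :
    ∃ c : ℕ, ∀ (h n : ℕ) (hh : 1 ≤ h) (V : Fin h → Type*) [∀ i, Fintype (V i)]
      (C : ∀ i, SimpleGraph (V i)) [∀ i, DecidableRel (C i).Adj] (Δ : Fin h → ℕ),
      (∀ i, Fintype.card (V i) = n) →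
      (∀ i, IsRegularCaterpillar (C i) (Δ i)) →
      Antitone Δ →
      Δ ⟨0, hh⟩ + h ≤ n →
      (∑ i, Δ i) + 1 ≤ n →
      (∑ i ∈ Finset.univ.erase (⟨0, hh⟩ : Fin h), (⌈(Δ i : ℝ) / 2⌉ : ℝ))
        < ((n : ℝ) - ((Δ ⟨0, hh⟩ : ℝ) - 1)) / 2 →
      ∃ k : ℕ, k ≤ c * Δ ⟨0, hh⟩ * h ^ 2 ∧
        ∃ G : SimpleGraph (Fin n), IsPacking C G ∧ IsKPlanar k G := by
  -- The bound `h * (2 * L)` on the crossings and `L ≤ 2 * (h * Δ o)` give the constant `4`.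
  refine ⟨4, fun h n hh V _ C _ Δ hcard hC hanti _ _ hsum => ?_⟩
  set o : Fin h := ⟨0, hh⟩ with ho
  let δ : Fin h → ℕ := fun i => (Δ i + 1) / 2
  -- Later caterpillars get lower windows. The window of `j` has `Δ j ≤ 2 * δ j` sums, so it ends
  -- before those of all `i < j`.
  let r : Fin h → ℕ := fun i => ∑ j ∈ Finset.Ioi i, δ j
  have hro : r o = ∑ i ∈ Finset.univ.erase o, δ i := by
    refine Finset.sum_congr (Finset.ext fun i => ?_) fun _ _ => rfl
    simp only [Finset.mem_Ioi, Finset.mem_erase, Finset.mem_univ, and_true, ho, Fin.lt_def,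
      ne_eq, Fin.ext_iff]
    omega
  have hr : ∀ i j, i < j → r j + δ j ≤ r i := by
    intro i j hij
    have h1 : r j + δ j = ∑ k ∈ insert j (Finset.Ioi j), δ k := by
      rw [Finset.sum_insert (by simp), add_comm]
    rw [h1]
    refine Finset.sum_le_sum_of_subset fun k hk => ?_
    rcases Finset.mem_insert.1 hk with rfl | hk
    · exact Finset.mem_Ioi.2 hij
    · exact Finset.mem_Ioi.2 (hij.trans (Finset.mem_Ioi.1 hk))
  set L : ℕ := 2 * r o + Δ o with hLdef
  have hLn : L ≤ n := by
    simp only [ceil_natCast_div_two, ← Nat.cast_sum] at hsum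
    change ((∑ i ∈ Finset.univ.erase o, δ i : ℕ) : ℝ) < _ at hsum
    rw [← hro] at hsum
    have : ((2 * r o + Δ o : ℕ) : ℝ) < ((n + 1 : ℕ) : ℝ) := by push_cast; linarith
    have := Nat.cast_lt.1 this
    omega
  have hLi : ∀ i, 2 * r i + Δ i ≤ L := by
    intro i
    rcases eq_or_ne i o with rfl | hi
    · exact le_rfl
    · have h1 := hr o i (by
        rw [Fin.lt_def]
        have : (i : ℕ) ≠ 0 := fun h => hi (Fin.ext h)
        exact Nat.pos_of_ne_zero this)
      have h2 : Δ i ≤ 2 * δ i := by simp only [δ]; omega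
      omega
  have hLh : L ≤ 2 * (h * Δ o) := by
    have hpos : 1 ≤ Δ o := by have := (hC o).2.1; omega
    have h1 : r o ≤ (h - 1) * Δ o := by
      rw [hro]
      refine (Finset.sum_le_card_nsmul _ _ (Δ o) fun i _ => ?_).trans ?_
      · have := hanti (show o ≤ i from Nat.zero_le _)
        have : 1 ≤ Δ i := by have := (hC i).2.1; omega
        simp only [δ]
        omega
      · simp
    obtain ⟨h', rfl⟩ : ∃ h', h = h' + 1 := ⟨h - 1, by omega⟩
    simp only [Nat.add_sub_cancel] at h1
    nlinarith
  choose η E hE using fun i => exists_placement (C i) (hC i) (hcard i) (r i)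
  refine ⟨h * (2 * L), by nlinarith [Nat.mul_le_mul_left (2 * h) hLh],
    ⨆ i, (C i).map (η i).toEmbedding, ⟨η, fun i => le_iSup (fun i => (C i).map (η i).toEmbedding) i,
    ?_⟩, ?_⟩
  all_goals
    have hedge : ∀ i, ∀ e ∈ ((C i).map (η i).toEmbedding).edgeSet,
        ∃ t, IsChordOf (1 + 2 * r i) (2 * r i + Δ i) t e ∧ E i t = e := by
      intro i e
      induction e with
      | _ x y =>
        rintro ⟨_, u, v, huv, rfl, rfl⟩
        exact hE i u v huv
  · have hlt : ∀ i j, i < j → Disjoint ((C i).map (η i).toEmbedding).edgeSet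
        ((C j).map (η j).toEmbedding).edgeSet := by
      intro i j hij
      rw [Set.disjoint_left]
      intro e hi hj
      obtain ⟨t, ht, _⟩ := hedge i e hi
      obtain ⟨t', ht', _⟩ := hedge j e hj
      have h1 := hr i j hij
      have h2 : Δ j ≤ 2 * δ j := by simp only [δ]; omega
      have h3 := hLi i
      exact ht'.not_of_lt ht (by omega) (by omega) (by omega)
    intro i j hij
    rcases lt_or_gt_of_ne hij with h | h
    · exact hlt i j h
    · exact (hlt j i h).symm
  · obtain ⟨D, hD⟩ := exists_convex_drawing (⨆ i, (C i).map (η i).toEmbedding)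
    have hall : ∀ e ∈ (⨆ i, (C i).map (η i).toEmbedding).edgeSet,
        ∃ i t, IsChordOf 1 L t e ∧ E i t = e := by
      intro e he
      have : ∃ i, e ∈ ((C i).map (η i).toEmbedding).edgeSet := by
        induction e with
        | _ x y => simpa only [SimpleGraph.mem_edgeSet, SimpleGraph.iSup_adj] using he
      obtain ⟨i, hi⟩ := this
      obtain ⟨t, ht, hEt⟩ := hedge i e hi
      have := hLi i
      exact ⟨i, t, ht.mono (by omega) (by omega), hEt⟩
    refine ⟨D, fun e => (hD e).trans ?_⟩
    obtain ⟨i, t, ht, _⟩ := hall e e.2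
    exact encard_crossings_le _ E hLn ht hall
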